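/- Let $q$ and $x$ be commuting indeterminates. For $n\in\mathbb{Z}$ put $[n]_q=(q^n-1)/(q-1)$, for $n\in\mathbb{N}=\{0,1,2,\dots\}$ put $[n]_q!=[1]_q[2]_q\cdots[n]_q$, and put $$\begin{bmatrix} n\\ m\end{bmatrix}_q=\frac{[n]_q!}{[n-m]_q!\,[m]_q!}\in\mathbb{Z}[q]\quad(0\le m\le n),\qquad \begin{bmatrix} n\\ m\end{bmatrix}_q=0\quad(m>n).$$ Let $$\mathcal{R}_q^+=\{P\in\mathbb{Q}(q)[x] : P([n]_q)\in\mathbb{Z}[q]\text{ for all }n\in\mathbb{N}\},\qquad \mathcal{R}_q=\{P\in\mathbb{Q}(q)[x] : P([n]_q)\in\mathbb{Z}[q,q^{-1}]\text{ for all }n\in\mathbb{Z}\}.$$ Both rings contain $q$ and the polynomials $$\begin{bmatrix} x\\ m\end{bmatrix}=\frac{x(x-[1]_q)\cdots(x-[m-1]_q)}{q^{\binom m2}[m]_q!}\qquad(m\in\mathbb{N}).$$ Let $\mathbf{k}$ be a field. If $\mathrm{char}(\mathbf{k})=0$ put $T=\mathbf{k}$, and for $s\in T$, $m\in\mathbb{N}$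 let $\binom{s}{m}=s(s-1)\cdots(s-m+1)/m!\in\mathbf{k}$. If $\mathrm{char}(\mathbf{k})=p>0$ put $T=\mathbb{Z}_p$ (the $p$-adic integers), and for $s=\sum_i s_ip^i\in T$ and $m=\sum_i m_ip^i\in\mathbb{N}$, written in base $p$ with digits $s_i,m_i\in\{0,\dots,p-1\}$, let $\binom{s}{m}=\prod_i\binom{s_i}{m_i}\in\mathbb{F}_p\subseteq\mathbf{k}$. **Theorem.** The ring homomorphisms $\varphi\colon\mathcal{R}_q^+\to\mathbf{k}$ are exactly the following. 1. For each $N\in\mathbb{N}\cup\{\infty\}$, the map with $\varphi(q)=0$ and, for all $m\in\mathbb{N}$, $\varphi\left(\begin{bmatrix} x\\ m\end{bmatrix}\right)=1$ if $m\le N$ and $=0$ otherwise. 2. For each positive integer $d$, each primitive $d$-th root of unity $\omega\in\mathbf{k}$, each $n_0\in\{0,\dots,d-1\}$ and each $t\in T$, the map with $\varphi(q)=\omega$ and, for all $m\in\mathbb{N}$, $$\varphi\left(\begin{bmatrix} x\\ m\end{bmatrix}\right)=\binom{(t-n_0)/d}{m'}\begin{bmatrix} n_0\\ m_0\end{bmatrix}_{q:=\omega},\qquad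 m=dm'+m_0,\quad 0\le m_0\le d-1.$$ (If $\mathrm{char}(\mathbf{k})=p>0$, then $p\nmid d$, so $d$ is a unit of $\mathbb{Z}_p$ and $(t-n_0)/d\in\mathbb{Z}_p$.) 3. For each $\kappa\in\mathbf{k}$ that is non-zero and not a root of unity and each $t\in\mathbf{k}$, the map with $\varphi(q)=\kappa$ and, for all $m\in\mathbb{N}$, $$\varphi\left(\begin{bmatrix} x\\ m\end{bmatrix}\right)=\begin{bmatrix} t\\ m\end{bmatrix}_{q:=\kappa}=\frac{t(t-[1]_\kappa)\cdots(t-[m-1]_\kappa)}{\kappa^{\binom m2}[m]_\kappa!},$$ where $[n]_\kappa=1+\kappa+\cdots+\kappa^{n-1}$ and $[m]_\kappa!=[1]_\kappa\cdots[m]_\kappa$ (which is non-zero). That is, for each choice of parameters in 1, 2 or 3 there is exactly one ring homomorphism with the stated values, and every ring homomorphism $\mathcal{R}_q^+\to\mathbf{k}$ arises from exactly one choice of parameters. The ring homomorphisms $\mathcal{R}_q\to\mathbf{k}$ are classified in the same way by the choices in 2 and 3 alone, with the same formulas; none of them sends $q$ to $0$. -/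

import Mathlib

namespace QIntVal

open Polynomial

noncomputable section

/-! ### `q`-numbers and `q`-binomial coefficients at an element of a field -/

/-- The `q`-number `[n]_κ = 1 + κ + ⋯ + κ ^ (n - 1)` for a natural number `n`. -/
def qNum {K : Type*} [Field K] (κ : K) (n : ℕ) : K := ∑ i ∈ Finset.range n, κ ^ i

/-- The `q`-factorial `[n]_κ! = [1]_κ [2]_κ ⋯ [n]_κ`. -/
def qFactorial {K : Type*} [Field K] (κ : K) (n : ℕ) : K :=
  ∏ i ∈ Finset.range n, qNum κ (i + 1)

/-- The `q`-binomial coefficient `[n choose m]_κ = [n]_κ! / ([n - m]_κ! [m]_κ!)`, which is `0` for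
`m > n`. It is used only where the denominator is non-zero, and is then the value at `κ` of the
polynomial `[n choose m]_q` with integer coefficients. -/
def qBinom {K : Type*} [Field K] (κ : K) (n m : ℕ) : K :=
  if m ≤ n then qFactorial κ n / (qFactorial κ (n - m) * qFactorial κ m) else 0

/-- The `q`-binomial coefficient polynomial
`[x choose m]_κ = x (x - [1]_κ) ⋯ (x - [m - 1]_κ) / (κ ^ (m choose 2) * [m]_κ!)`.
It is used only where the denominator is non-zero. -/
def qBinomPoly {K : Type*} [Field K] (κ : K) (m : ℕ) : K[X] :=
  C (κ ^ m.choose 2 * qFactorial κ m)⁻¹ * ∏ i ∈ Finset.range m, (X - C (qNum κ i))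

/-! ### The rings of quantum integer-valued polynomials -/

/-- The indeterminate `q` of the field `ℚ(q)` of rational functions. -/
def qv : RatFunc ℚ := RatFunc.X

/-- The `q`-number `[n]_q = (q ^ n - 1) / (q - 1)` in `ℚ(q)`, for an arbitrary integer `n`. -/
def qInt (n : ℤ) : RatFunc ℚ := (qv ^ n - 1) / (qv - 1)

/-- `ℤ[q]` inside `ℚ(q)`. -/
def intPoly : Subalgebra ℤ (RatFunc ℚ) := Algebra.adjoin ℤ {qv}

/-- `ℤ[q, q⁻¹]` inside `ℚ(q)`. -/
def intLaurent : Subalgebra ℤ (RatFunc ℚ) := Algebra.adjoin ℤ {qv, qv⁻¹}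

/-- The ring `R_q^+` of all `P ∈ ℚ(q)[x]` with `P([n]_q) ∈ ℤ[q]` for all `n ∈ ℕ`. -/
def RqPlus : Subring (RatFunc ℚ)[X] where
  carrier := {P | ∀ n : ℕ, P.eval (qInt n) ∈ intPoly}
  mul_mem' hP hQ n := by rw [eval_mul]; exact mul_mem (hP n) (hQ n)
  one_mem' n := by rw [eval_one]; exact one_mem _
  add_mem' hP hQ n := by rw [eval_add]; exact add_mem (hP n) (hQ n)
  zero_mem' n := by rw [eval_zero]; exact zero_mem _
  neg_mem' hP n := by rw [eval_neg]; exact neg_mem (hP n)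

/-- The ring `R_q` of all `P ∈ ℚ(q)[x]` with `P([n]_q) ∈ ℤ[q, q⁻¹]` for all `n ∈ ℤ`. -/
def Rq : Subring (RatFunc ℚ)[X] where
  carrier := {P | ∀ n : ℤ, P.eval (qInt n) ∈ intLaurent}
  mul_mem' hP hQ n := by rw [eval_mul]; exact mul_mem (hP n) (hQ n)
  one_mem' n := by rw [eval_one]; exact one_mem _
  add_mem' hP hQ n := by rw [eval_add]; exact add_mem (hP n) (hQ n)
  zero_mem' n := by rw [eval_zero]; exact zero_mem _
  neg_mem' hP n := by rw [eval_neg]; exact neg_mem (hP n)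

/-! ### The elements `q` and `[x choose m]_q` lie in both rings -/

theorem qv_ne_zero : qv ≠ 0 := RatFunc.X_ne_zero

theorem qv_pow_ne_one {n : ℕ} (hn : n ≠ 0) : qv ^ n ≠ 1 := by
  intro h
  have h1 : algebraMap ℚ[X] (RatFunc ℚ) (X ^ n) = algebraMap ℚ[X] (RatFunc ℚ) 1 := by
    rw [map_pow, RatFunc.algebraMap_X, map_one]; exact h
  have h2 := congrArg Polynomial.natDegree (IsFractionRing.injective ℚ[X] (RatFunc ℚ) h1)
  rw [natDegree_X_pow, natDegree_one] at h2
  exact hn h2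

theorem qv_sub_one_ne_zero : qv - 1 ≠ 0 := by
  have h := qv_pow_ne_one one_ne_zero
  rw [pow_one] at h
  exact sub_ne_zero.mpr h

theorem qNum_qv (n : ℕ) : qNum qv n = qInt n := by
  have h := geom_sum_mul qv n
  rw [qInt, zpow_natCast, eq_div_iff qv_sub_one_ne_zero]
  exact h

theorem qNum_qv_ne_zero (n : ℕ) : qNum qv (n + 1) ≠ 0 := by
  rw [qNum_qv, qInt, zpow_natCast]
  exact div_ne_zero (sub_ne_zero.mpr (qv_pow_ne_one n.succ_ne_zero)) qv_sub_one_ne_zero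

theorem qFactorial_qv_ne_zero (n : ℕ) : qFactorial qv n ≠ 0 :=
  Finset.prod_ne_zero_iff.mpr fun i _ => qNum_qv_ne_zero i

theorem qInt_add_one (n : ℤ) : qInt (n + 1) = qv * qInt n + 1 := by
  rw [qInt, qInt, zpow_add_one₀ qv_ne_zero]
  have := qv_sub_one_ne_zero
  field_simp
  ring

theorem qNum_succ {K : Type*} [Field K] (κ : K) (n : ℕ) : qNum κ (n + 1) = κ * qNum κ n + 1 := by
  rw [qNum, qNum, Finset.sum_range_succ', Finset.mul_sum, pow_zero]
  congr 1
  exact Finset.sum_congr rfl fun i _ => pow_succ' κ i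

theorem eval_qBinomPoly (m : ℕ) (y : RatFunc ℚ) : (qBinomPoly qv m).eval y =
    (∏ i ∈ Finset.range m, (y - qNum qv i)) / (qv ^ m.choose 2 * qFactorial qv m) := by
  rw [qBinomPoly, eval_mul, eval_C, eval_prod, div_eq_inv_mul]
  simp

/-- The `q`-Pascal identity for the `q`-binomial coefficient polynomials. -/
theorem eval_qBinomPoly_succ (m : ℕ) (y : RatFunc ℚ) :
    (qBinomPoly qv (m + 1)).eval (qv * y + 1) =
      qv ^ (m + 1) * (qBinomPoly qv (m + 1)).eval y + (qBinomPoly qv m).eval y := by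
  have hP : ∏ i ∈ Finset.range (m + 1), (qv * y + 1 - qNum qv i) =
      qv ^ m * (∏ i ∈ Finset.range m, (y - qNum qv i)) * (qv * y + 1) := by
    rw [Finset.prod_range_succ']
    have h : ∀ i ∈ Finset.range m, qv * y + 1 - qNum qv (i + 1) = qv * (y - qNum qv i) := by
      intro i _
      rw [qNum_succ]; ring
    rw [Finset.prod_congr rfl h, Finset.prod_mul_distrib, Finset.prod_const, Finset.card_range]
    simp [qNum]
  have hF : qFactorial qv (m + 1) = qFactorial qv m * qNum qv (m + 1) :=
    Finset.prod_range_succ _ _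
  have hC : (m + 1).choose 2 = m + m.choose 2 := by
    rw [Nat.choose_succ_succ' m 1, Nat.choose_one_right]
  rw [eval_qBinomPoly, eval_qBinomPoly, eval_qBinomPoly, hP, hF, hC, Finset.prod_range_succ]
  have h0 := qv_ne_zero
  have h1 := qFactorial_qv_ne_zero m
  have h2 := qNum_qv_ne_zero m
  have h3 := qNum_succ qv m
  rw [pow_add]
  field_simp
  rw [h3]
  ring

theorem qBinomPoly_qv_zero : qBinomPoly qv 0 = 1 := by
  simp [qBinomPoly, qFactorial]

theorem eval_qBinomPoly_zero (m : ℕ) : (qBinomPoly qv (m + 1)).eval (qInt 0) = 0 := by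
  rw [eval_qBinomPoly, Finset.prod_range_succ']
  simp [qNum, qInt]

theorem qBinomPoly_mem_RqPlus (m : ℕ) : qBinomPoly qv m ∈ RqPlus := by
  have hq : qv ∈ intPoly := Algebra.subset_adjoin rfl
  induction m with
  | zero => rw [qBinomPoly_qv_zero]; exact one_mem _
  | succ m ih =>
    intro n
    induction n with
    | zero =>
      have h := eval_qBinomPoly_zero m
      rw [Nat.cast_zero, h]; exact zero_mem _
    | succ n ihn =>
      rw [Nat.cast_succ, qInt_add_one, eval_qBinomPoly_succ]
      exact add_mem (mul_mem (pow_mem hq _) ihn) (ih n)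

theorem qBinomPoly_mem_Rq (m : ℕ) : qBinomPoly qv m ∈ Rq := by
  have hq : qv ∈ intLaurent := Algebra.subset_adjoin (by simp)
  have hq' : qv⁻¹ ∈ intLaurent := Algebra.subset_adjoin (by simp)
  induction m with
  | zero => rw [qBinomPoly_qv_zero]; exact one_mem _
  | succ m ih =>
    intro n
    induction n using Int.induction_on with
    | zero => rw [eval_qBinomPoly_zero]; exact zero_mem _
    | succ n ihn =>
      rw [qInt_add_one, eval_qBinomPoly_succ]
      exact add_mem (mul_mem (pow_mem hq _) ihn) (ih n)
    | pred n ihn =>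
      have h := eval_qBinomPoly_succ m (qInt (-(n : ℤ) - 1))
      rw [← qInt_add_one, sub_add_cancel] at h
      have h' : (qBinomPoly qv (m + 1)).eval (qInt (-(n : ℤ) - 1)) =
          qv⁻¹ ^ (m + 1) * ((qBinomPoly qv (m + 1)).eval (qInt (-(n : ℤ))) -
            (qBinomPoly qv m).eval (qInt (-(n : ℤ) - 1))) := by
        rw [h, add_sub_cancel_right, ← mul_assoc, ← mul_pow, inv_mul_cancel₀ qv_ne_zero, one_pow,
          one_mul]
      rw [h']
      exact mul_mem (pow_mem hq' _) (sub_mem ihn (ih _))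

/-- The constant polynomial `q`, as an element of `R_q^+`. -/
def RqPlus.q : RqPlus :=
  ⟨C qv, fun n => by rw [eval_C]; exact Algebra.subset_adjoin rfl⟩

/-- The polynomial `[x choose m]_q`, as an element of `R_q^+`. -/
def RqPlus.binom (m : ℕ) : RqPlus := ⟨qBinomPoly qv m, qBinomPoly_mem_RqPlus m⟩

/-- The constant polynomial `q`, as an element of `R_q`. -/
def Rq.q : Rq :=
  ⟨C qv, fun n => by rw [eval_C]; exact Algebra.subset_adjoin (by simp)⟩

/-- The polynomial `[x choose m]_q`, as an element of `R_q`. -/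
def Rq.binom (m : ℕ) : Rq := ⟨qBinomPoly qv m, qBinomPoly_mem_Rq m⟩

/-! ### Ordinary binomial coefficients with values in a field -/

/-- For an element `t` of a field of characteristic zero,
`(t choose m) = t (t - 1) ⋯ (t - m + 1) / m!`. -/
def binomZero {k : Type*} [Field k] (t : k) (m : ℕ) : k :=
  (∏ i ∈ Finset.range m, (t - (i : k))) / (m.factorial : k)

/-- The `i`-th digit `t_i ∈ {0, …, p - 1}` of the `p`-adic integer `t = ∑ t_i p ^ i`: the residue
of `t` modulo `p ^ (i + 1)` is `t_0 + t_1 p + ⋯ + t_i p ^ i`. -/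
def padicDigit {p : ℕ} [Fact p.Prime] (t : ℤ_[p]) (i : ℕ) : ℕ :=
  (PadicInt.toZModPow (i + 1) t).val / p ^ i

/-- For a `p`-adic integer `t` with digits `t_i` and a natural number `m` with base-`p` digits
`m_i`, the element `(t choose m) = ∏ i, (t_i choose m_i)` of the prime field, viewed in a field `k`
of characteristic `p`. Since `m < p ^ (m + 1)`, the factors with `i > m` would all be `1`. -/
def binomPadic (k : Type*) [Field k] {p : ℕ} [Fact p.Prime] (t : ℤ_[p]) (m : ℕ) : k :=
  ∏ i ∈ Finset.range (m + 1), ((padicDigit t i).choose (m / p ^ i % p) : k)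

/-- The `p`-adic integer `(t - n) / d`, for a natural number `d` prime to `p`, which is therefore a
unit of `ℤ_p`. -/
def padicShift {p : ℕ} [Fact p.Prime] (d n : ℕ) (t : ℤ_[p]) : ℤ_[p] :=
  (t - (n : ℤ_[p])) * Ring.inverse (d : ℤ_[p])

end

end QIntVal

namespace QIntVal

open Polynomial

noncomputable section

/-! ### Gaussian binomial coefficients over a commutative ring -/

/-- The Gaussian binomial coefficient at an arbitrary element `κ` of a commutative semiring, defined
by the `q`-Pascal recursion. -/
def gaussCoeff {A : Type*} [CommSemiring A] (κ : A) : ℕ → ℕ → A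
  | _, 0 => 1
  | 0, _ + 1 => 0
  | n + 1, m + 1 => κ ^ (m + 1) * gaussCoeff κ n (m + 1) + gaussCoeff κ n m

section gaussCoeff

variable {A : Type*} [CommSemiring A] (κ : A)

@[simp] theorem gaussCoeff_zero_right (n : ℕ) : gaussCoeff κ n 0 = 1 := by
  cases n <;> rfl

@[simp] theorem gaussCoeff_zero_succ (m : ℕ) : gaussCoeff κ 0 (m + 1) = 0 := rfl

theorem gaussCoeff_succ_succ (n m : ℕ) :
    gaussCoeff κ (n + 1) (m + 1) = κ ^ (m + 1) * gaussCoeff κ n (m + 1) + gaussCoeff κ n m := rfl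

theorem gaussCoeff_eq_zero_of_lt {n m : ℕ} (h : n < m) : gaussCoeff κ n m = 0 := by
  induction n generalizing m with
  | zero =>
    obtain ⟨m, rfl⟩ := Nat.exists_eq_succ_of_ne_zero h.ne'
    rfl
  | succ n ih =>
    obtain ⟨m, rfl⟩ := Nat.exists_eq_succ_of_ne_zero (Nat.ne_zero_of_lt h)
    rw [Nat.succ_eq_add_one, gaussCoeff_succ_succ, ih (by omega), ih (by omega), mul_zero, add_zero]

@[simp] theorem gaussCoeff_self (n : ℕ) : gaussCoeff κ n n = 1 := by
  induction n with
  | zero => rfl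
  | succ n ih =>
    rw [gaussCoeff_succ_succ, ih, gaussCoeff_eq_zero_of_lt κ n.lt_succ_self, mul_zero, zero_add]

theorem map_gaussCoeff {A' : Type*} [CommSemiring A'] (f : A →+* A') (n m : ℕ) :
    f (gaussCoeff κ n m) = gaussCoeff (f κ) n m := by
  induction n generalizing m with
  | zero => cases m <;> simp
  | succ n ih => cases m <;> simp [gaussCoeff_succ_succ, ih]

theorem gaussCoeff_one_eq_choose (n m : ℕ) : gaussCoeff (1 : A) n m = (n.choose m : A) := by
  induction n generalizing m with
  | zero => cases m <;> simp
  | succ n ih =>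
    cases m with
    | zero => simp
    | succ m =>
      rw [gaussCoeff_succ_succ, ih, ih, Nat.choose_succ_succ', one_pow, one_mul, Nat.cast_add,
        add_comm]

theorem gaussCoeff_zero_left (n m : ℕ) :
    gaussCoeff (0 : A) n m = if m ≤ n then 1 else 0 := by
  induction n generalizing m with
  | zero => cases m <;> simp
  | succ n ih => cases m <;> simp [gaussCoeff_succ_succ, ih]

end gaussCoeff

/-! ### Limits of point sets under polynomial relations -/

/-- The closure in `k ^ ℕ` of a set of points, with respect to polynomial relations over `k`. -/
def polyClosure {ι k : Type*} [Field k] (b : ι → ℕ → k) : Set (ℕ → k) :=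
  {v | ∀ F : MvPolynomial ℕ k, (∀ i, MvPolynomial.eval (b i) F = 0) → MvPolynomial.eval v F = 0}

/-- A triangular family of points separates linear forms. -/
theorem eq_zero_of_forall_sum_eq_zero {k : Type*} [Field k] (b : ℕ → ℕ → k)
    (hb0 : ∀ n m, n < m → b n m = 0) (hb1 : ∀ n, b n n = 1) (h : ℕ →₀ k)
    (hh : ∀ n, (h.sum fun m c => c * b n m) = 0) : h = 0 := by
  ext n
  induction n using Nat.strong_induction_on with
  | _ n ih =>
    have := hh n
    rw [Finsupp.sum, Finset.sum_eq_single n, hb1, mul_one] at this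
    · exact this
    · intro m _ hmn
      rcases lt_or_gt_of_ne hmn with hlt | hgt
      · rw [ih m hlt, Finsupp.zero_apply, zero_mul]
      · rw [hb0 n m hgt, mul_zero]
    · intro hn
      rw [Finsupp.notMem_support_iff.mp hn, zero_mul]

section correspondence

variable {S R k : Type*} [CommRing S] [CommRing R] [Field k] (i : S →+* R) (B : ℕ → R)
  (hspan : ∀ P : R, ∃ c : ℕ →₀ S, P = c.sum fun m s => i s * B m)
  (ev : ℕ → R →+* S) (hev : ∀ n s, ev n (i s) = s) (g : S →+* k)

include hspan in
theorem ringHom_ext_of_span {φ ψ : R →+* k} (hi : ∀ s, φ (i s) = ψ (i s))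
    (hB : ∀ m, φ (B m) = ψ (B m)) : φ = ψ := by
  ext P
  obtain ⟨c, rfl⟩ := hspan P
  simp only [Finsupp.sum, map_sum, map_mul, hi, hB]

include hspan hev in
theorem exists_ringHom_of_mem_polyClosure {v : ℕ → k}
    (hv : v ∈ polyClosure fun n m => g (ev n (B m))) :
    ∃ φ : R →+* k, (∀ s, φ (i s) = g s) ∧ ∀ m, φ (B m) = v m := by
  have key : ∀ P, ∃ F : MvPolynomial ℕ k, ∀ n,
      MvPolynomial.eval (fun m => g (ev n (B m))) F = g (ev n P) := by
    intro P
    obtain ⟨c, rfl⟩ := hspan P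
    refine ⟨c.sum fun m s => MvPolynomial.C (g s) * MvPolynomial.X m, fun n => ?_⟩
    simp [Finsupp.sum, hev]
  choose F hF using key
  have hF' : ∀ P G, (∀ n, MvPolynomial.eval (fun m => g (ev n (B m))) G = g (ev n P)) →
      MvPolynomial.eval v (F P) = MvPolynomial.eval v G := by
    intro P G hG
    have := hv (F P - G) fun n => by rw [map_sub, hF, hG, sub_self]
    rwa [map_sub, sub_eq_zero] at this
  refine ⟨{ toFun := fun P => MvPolynomial.eval v (F P)
            map_one' := ?_
            map_mul' := fun P Q => ?_
            map_zero' := ?_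
            map_add' := fun P Q => ?_ }, fun s => ?_, fun m => ?_⟩
  · rw [hF' 1 1 (by simp), map_one]
  · rw [hF' (P * Q) (F P * F Q) (by simp [hF]), map_mul]
  · rw [hF' 0 0 (by simp), map_zero]
  · rw [hF' (P + Q) (F P + F Q) (by simp [hF]), map_add]
  · exact (hF' (i s) (MvPolynomial.C (g s)) (by simp [hev])).trans (MvPolynomial.eval_C _)
  · exact (hF' (B m) (MvPolynomial.X m) (by simp)).trans (MvPolynomial.eval_X _)

include hspan in
/-- A polynomial in the values of a ring homomorphism at the `B m` is a linear form in them, and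
this form depends only on the homomorphism on the base ring. -/
theorem exists_linear_form (F : MvPolynomial ℕ k) : ∃ h : ℕ →₀ k, ∀ ψ : R →+* k,
    (∀ s, ψ (i s) = g s) →
      MvPolynomial.eval (fun m => ψ (B m)) F = h.sum fun m c => c * ψ (B m) := by
  induction F using MvPolynomial.induction_on with
  | C a =>
    obtain ⟨c, hc⟩ := hspan 1
    refine ⟨a • c.mapRange g (map_zero g), fun ψ hψ => ?_⟩
    have h1 := congrArg ψ hc
    rw [map_one, map_finsuppSum] at h1
    rw [MvPolynomial.eval_C, Finsupp.sum_smul_index (by simp),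
      Finsupp.sum_mapRange_index (by simp)]
    calc a = a * 1 := (mul_one a).symm
      _ = _ := by
        rw [h1, Finsupp.mul_sum]
        exact Finsupp.sum_congr fun m _ => by rw [map_mul, hψ, mul_assoc]
  | add F G hF hG =>
    obtain ⟨h, hh⟩ := hF
    obtain ⟨h', hh'⟩ := hG
    refine ⟨h + h', fun ψ hψ => ?_⟩
    rw [map_add, hh ψ hψ, hh' ψ hψ, Finsupp.sum_add_index' (by simp) (by intros; ring)]
  | mul_X F j hF =>
    obtain ⟨h, hh⟩ := hF
    choose c hc using fun m => hspan (B m * B j)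
    refine ⟨h.sum fun m a => a • (c m).mapRange g (map_zero g), fun ψ hψ => ?_⟩
    have h1 : ∀ m, ψ (B m) * ψ (B j) = (c m).sum fun l s => g s * ψ (B l) := by
      intro m
      rw [← map_mul, hc, map_finsuppSum]
      exact Finsupp.sum_congr fun m _ => by rw [map_mul, hψ]
    rw [map_mul, hh ψ hψ, MvPolynomial.eval_X, Finsupp.sum_mul,
      Finsupp.sum_sum_index (by simp) (by intros; ring)]
    refine Finsupp.sum_congr fun m _ => ?_
    rw [mul_assoc, h1, Finsupp.sum_smul_index (by simp), Finsupp.sum_mapRange_index (by simp),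
      Finsupp.mul_sum]
    exact Finsupp.sum_congr fun l _ => by rw [mul_assoc]

include hspan hev in
theorem mem_polyClosure_of_ringHom (hb0 : ∀ n m, n < m → ev n (B m) = 0)
    (hb1 : ∀ n, ev n (B n) = 1) {φ : R →+* k} (hφ : ∀ s, φ (i s) = g s) :
    (fun m => φ (B m)) ∈ polyClosure fun n m => g (ev n (B m)) := by
  intro F hF
  obtain ⟨h, hh⟩ := exists_linear_form i B hspan g F
  have h0 : h = 0 := by
    refine eq_zero_of_forall_sum_eq_zero (fun n m => g (ev n (B m)))
      (fun n m hnm => by rw [hb0 n m hnm, map_zero]) (fun n => by rw [hb1, map_one]) h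
      fun n => ?_
    rw [← hF n]
    exact (hh (g.comp (ev n)) fun s => by rw [RingHom.comp_apply, hev]).symm
  rw [hh φ hφ, h0, Finsupp.sum_zero_index]

end correspondence

/-! ### Newton expansions -/

theorem eval_qBinomPoly_qInt (n m : ℕ) : (qBinomPoly qv m).eval (qInt n) = gaussCoeff qv n m := by
  induction n generalizing m with
  | zero =>
    cases m with
    | zero => simp [qBinomPoly_qv_zero]
    | succ m => rw [Nat.cast_zero, eval_qBinomPoly_zero, gaussCoeff_zero_succ]
  | succ n ih =>
    cases m with
    | zero => simp [qBinomPoly_qv_zero]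
    | succ m => rw [Nat.cast_succ, qInt_add_one, eval_qBinomPoly_succ, ih, ih, gaussCoeff_succ_succ]

theorem natDegree_qBinomPoly_le {K : Type*} [Field K] (κ : K) (m : ℕ) :
    (qBinomPoly κ m).natDegree ≤ m := by
  refine (natDegree_C_mul_le _ _).trans ((natDegree_prod_le _ _).trans ?_)
  simp

theorem qInt_natCast_injective : Function.Injective fun n : ℕ => qInt n := by
  intro a b hab
  have h : qv ^ a = qv ^ b := by
    simpa [qInt, div_left_inj' qv_sub_one_ne_zero] using hab
  by_contra hne
  rcases lt_or_gt_of_ne hne with hlt | hlt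
  · refine qv_pow_ne_one (Nat.sub_ne_zero_of_lt hlt) ?_
    rw [pow_sub₀ _ qv_ne_zero hlt.le, h, mul_inv_cancel₀ (pow_ne_zero _ qv_ne_zero)]
  · refine qv_pow_ne_one (Nat.sub_ne_zero_of_lt hlt) ?_
    rw [pow_sub₀ _ qv_ne_zero hlt.le, h, mul_inv_cancel₀ (pow_ne_zero _ qv_ne_zero)]

theorem gaussCoeff_qv_mem {S : Subalgebra ℤ (RatFunc ℚ)} (hq : qv ∈ S) (n m : ℕ) :
    gaussCoeff qv n m ∈ S := by
  have := map_gaussCoeff (⟨qv, hq⟩ : S) S.val.toRingHom n m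
  change _ = gaussCoeff qv n m at this
  rw [← this]
  exact Subtype.property _

/-- A polynomial with values in `S` at all `[n]_q`, `n ∈ ℕ`, is an `S`-linear combination of the
`q`-binomial coefficient polynomials. -/
theorem exists_newton_expansion {S : Subalgebra ℤ (RatFunc ℚ)} (hq : qv ∈ S)
    {P : (RatFunc ℚ)[X]} (hP : ∀ n : ℕ, P.eval (qInt n) ∈ S) :
    ∃ c : ℕ →₀ S, P = c.sum fun m s => C (s : RatFunc ℚ) * qBinomPoly qv m := by
  have key : ∀ N : ℕ, ∃ c : ℕ → S, ∀ n < N,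
      P.eval (qInt n) = ∑ m ∈ Finset.range N, (c m : RatFunc ℚ) * gaussCoeff qv n m := by
    intro N
    induction N with
    | zero => exact ⟨0, by simp⟩
    | succ N ih =>
      obtain ⟨c, hc⟩ := ih
      let s : S := ⟨P.eval (qInt N), hP N⟩ -
        ∑ m ∈ Finset.range N, c m * ⟨gaussCoeff qv N m, gaussCoeff_qv_mem hq N m⟩
      refine ⟨Function.update c N s, fun n hn => ?_⟩
      have hsum : ∑ m ∈ Finset.range N, (Function.update c N s m : RatFunc ℚ) * gaussCoeff qv n m =
          ∑ m ∈ Finset.range N, (c m : RatFunc ℚ) * gaussCoeff qv n m := by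
        refine Finset.sum_congr rfl fun m hm => ?_
        rw [Function.update_of_ne (Finset.mem_range.mp hm).ne]
      rw [Finset.sum_range_succ, Function.update_self, hsum]
      rcases Nat.lt_succ_iff_lt_or_eq.mp hn with h | rfl
      · rw [hc n h, gaussCoeff_eq_zero_of_lt _ h, mul_zero, add_zero]
      · simp [s]
  obtain ⟨c, hc⟩ := key (P.natDegree + 1)
  refine ⟨Finsupp.onFinset (Finset.range (P.natDegree + 1))
    (fun m => if m ∈ Finset.range (P.natDegree + 1) then c m else 0)
    (fun m hm => by by_contra h; exact hm (if_neg h)), ?_⟩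
  rw [Finsupp.onFinset_sum _ (by simp), ← sub_eq_zero]
  refine eq_zero_of_natDegree_lt_card_of_eval_eq_zero _
    (f := fun n : Fin (P.natDegree + 1) => qInt ((n : ℕ) : ℤ))
    (fun a b h => Fin.ext (qInt_natCast_injective h)) (fun n => ?_) ?_
  · rw [eval_sub, hc n n.2, eval_finsetSum, sub_eq_zero]
    refine Finset.sum_congr rfl fun m hm => ?_
    rw [if_pos hm, eval_mul, eval_C, eval_qBinomPoly_qInt]
  · rw [Fintype.card_fin, Nat.lt_succ_iff]
    refine (natDegree_sub_le _ _).trans (max_le le_rfl ?_)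
    refine natDegree_sum_le_of_forall_le _ _ fun m hm => ?_
    exact (natDegree_C_mul_le _ _).trans
      ((natDegree_qBinomPoly_le _ _).trans (Nat.lt_succ_iff.mp (Finset.mem_range.mp hm)))

/-! ### Specializations of `ℤ[q]` and `ℤ[q, q⁻¹]` -/

/-- `ℤ[q]` is the image of `ℤ[X]`. -/
def intPolyEval : ℤ[X] →+* RatFunc ℚ := eval₂RingHom (Int.castRingHom _) qv

theorem intPolyEval_X : intPolyEval X = qv := by simp [intPolyEval]

theorem intPolyEval_injective : Function.Injective intPolyEval := by
  have h : intPolyEval = (algebraMap ℚ[X] (RatFunc ℚ)).comp (mapRingHom (Int.castRingHom ℚ)) := by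
    refine Polynomial.ringHom_ext' (RingHom.ext_int _ _) ?_
    simp [intPolyEval_X, qv]
  rw [h]
  exact (IsFractionRing.injective ℚ[X] (RatFunc ℚ)).comp
    (map_injective _ (Int.castRingHom ℚ).injective_int)

/-- `ℤ[q, q⁻¹]` is the image of the ring of Laurent polynomials. -/
def intLaurentEval : LaurentPolynomial ℤ →+* RatFunc ℚ :=
  LaurentPolynomial.eval₂ (Int.castRingHom _) (Units.mk0 qv qv_ne_zero)

theorem intLaurentEval_T (n : ℤ) : intLaurentEval (LaurentPolynomial.T n) = qv ^ n := by
  simp [intLaurentEval]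

theorem intLaurentEval_injective : Function.Injective intLaurentEval := by
  rw [injective_iff_map_eq_zero]
  intro a ha
  obtain ⟨n, a', ha'⟩ := a.exists_T_pow
  have h0 : intPolyEval a' = 0 := by
    have := congrArg intLaurentEval ha'
    rw [map_mul, ha, zero_mul, intLaurentEval, LaurentPolynomial.eval₂_toLaurent] at this
    exact this
  rw [(map_eq_zero_iff _ intPolyEval_injective).mp h0, map_zero] at ha'
  exact ((LaurentPolynomial.isUnit_T (n : ℤ)).mul_left_eq_zero).mp ha'.symm

section adjoin

variable {L : Type*} [CommRing L] [Algebra ℤ L]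

theorem exists_ringHom_adjoin {A k : Type*} [CommRing A] [CommRing k] {X : Set L}
    (f : A →+* L) (hf : Function.Injective f) (hX : X ⊆ f.range)
    (h : A →+* k) : ∃ g : Algebra.adjoin ℤ X →+* k,
      ∀ (a : A) (s : Algebra.adjoin ℤ X), f a = s → g s = h a := by
  have hS : ∀ s ∈ Algebra.adjoin ℤ X, s ∈ f.range := by
    intro s hs
    induction hs using Algebra.adjoin_induction with
    | mem x hx => exact hX hx
    | algebraMap n => exact ⟨n, by rw [map_intCast, eq_intCast (algebraMap ℤ L)]⟩
    | add x y _ _ hx hy => exact add_mem hx hy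
    | mul x y _ _ hx hy => exact mul_mem hx hy
  have hbij : Function.Bijective f.rangeRestrict :=
    ⟨fun a b hab => hf (congrArg Subtype.val hab), f.rangeRestrict_surjective⟩
  refine ⟨(h.comp (RingEquiv.ofBijective _ hbij).symm.toRingHom).comp
    ((Algebra.adjoin ℤ X).val.toRingHom.codRestrict f.range fun s => hS s s.2), fun a s has => ?_⟩
  change h ((RingEquiv.ofBijective _ hbij).symm ⟨s, hS s s.2⟩) = h a
  congr 1
  rw [RingEquiv.symm_apply_eq]
  exact Subtype.ext has.symm

theorem ringHom_adjoin_ext {k : Type*} [CommRing k] {X : Set L} {f g : Algebra.adjoin ℤ X →+* k}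
    (h : ∀ x (hx : x ∈ X), f ⟨x, Algebra.subset_adjoin hx⟩ = g ⟨x, Algebra.subset_adjoin hx⟩) :
    f = g := by
  ext ⟨x, hx⟩
  induction hx using Algebra.adjoin_induction with
  | mem x hx => exact h x hx
  | algebraMap n =>
    have : ∀ F : Algebra.adjoin ℤ X →+* k,
        F ⟨algebraMap ℤ L n, Subalgebra.algebraMap_mem _ n⟩ = n := fun F =>
      (congrArg F (eq_intCast (algebraMap ℤ (Algebra.adjoin ℤ X)) n)).trans (map_intCast F n)
    rw [this, this]
  | add x y hx hy ihx ihy =>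
    have : ∀ F : Algebra.adjoin ℤ X →+* k, F ⟨x + y, add_mem hx hy⟩ = F ⟨x, hx⟩ + F ⟨y, hy⟩ :=
      fun F => map_add F ⟨x, hx⟩ ⟨y, hy⟩
    rw [this, this, ihx, ihy]
  | mul x y hx hy ihx ihy =>
    have : ∀ F : Algebra.adjoin ℤ X →+* k, F ⟨x * y, mul_mem hx hy⟩ = F ⟨x, hx⟩ * F ⟨y, hy⟩ :=
      fun F => map_mul F ⟨x, hx⟩ ⟨y, hy⟩
    rw [this, this, ihx, ihy]

end adjoin

theorem qv_mem_intPoly : qv ∈ intPoly := Algebra.subset_adjoin rfl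

theorem qv_mem_intLaurent : qv ∈ intLaurent := Algebra.subset_adjoin (by simp)

theorem qv_inv_mem_intLaurent : qv⁻¹ ∈ intLaurent := Algebra.subset_adjoin (by simp)

section specialization

variable {k : Type*} [Field k]

theorem exists_ringHom_intPoly (κ : k) : ∃ g : intPoly →+* k, g ⟨qv, qv_mem_intPoly⟩ = κ := by
  obtain ⟨g, hg⟩ := exists_ringHom_adjoin (X := {qv}) intPolyEval intPolyEval_injective
    (by rintro x rfl; exact ⟨X, intPolyEval_X⟩) (eval₂RingHom (Int.castRingHom k) κ)
  exact ⟨g, (hg X _ intPolyEval_X).trans (by simp)⟩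

theorem exists_ringHom_intLaurent {κ : k} (hκ : κ ≠ 0) :
    ∃ g : intLaurent →+* k, g ⟨qv, qv_mem_intLaurent⟩ = κ := by
  have h1 := intLaurentEval_T 1
  have h2 := intLaurentEval_T (-1)
  rw [zpow_one] at h1
  rw [zpow_neg_one] at h2
  obtain ⟨g, hg⟩ := exists_ringHom_adjoin (X := {qv, qv⁻¹}) intLaurentEval
    intLaurentEval_injective
    (by
      rintro x (rfl | rfl)
      · exact ⟨_, h1⟩
      · exact ⟨_, h2⟩)
    (LaurentPolynomial.eval₂ (Int.castRingHom k) (Units.mk0 κ hκ))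
  exact ⟨g, (hg (LaurentPolynomial.T 1) _ h1).trans (by simp)⟩

theorem ringHom_intPoly_ext {f g : intPoly →+* k}
    (h : f ⟨qv, qv_mem_intPoly⟩ = g ⟨qv, qv_mem_intPoly⟩) : f = g :=
  ringHom_adjoin_ext (by rintro x rfl; exact h)

theorem map_intLaurent_qv_mul_inv (f : intLaurent →+* k) :
    f ⟨qv, qv_mem_intLaurent⟩ * f ⟨qv⁻¹, qv_inv_mem_intLaurent⟩ = 1 := by
  rw [← map_mul, ← map_one f]
  exact congrArg f (Subtype.ext (mul_inv_cancel₀ qv_ne_zero))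

theorem ringHom_intLaurent_ext {f g : intLaurent →+* k}
    (h : f ⟨qv, qv_mem_intLaurent⟩ = g ⟨qv, qv_mem_intLaurent⟩) : f = g := by
  refine ringHom_adjoin_ext ?_
  rintro x (rfl | rfl)
  · exact h
  · have hf := map_intLaurent_qv_mul_inv f
    have hg := map_intLaurent_qv_mul_inv g
    rw [h] at hf
    exact mul_left_cancel₀ (left_ne_zero_of_mul_eq_one hg) (hf.trans hg.symm)

end specialization

/-! ### Ring homomorphisms and limits of Gaussian binomial coefficients -/

/-- The inclusion of the constants in `R_q^+`. -/
def RqPlus.const : intPoly →+* RqPlus :=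
  ((C : RatFunc ℚ →+* _).comp intPoly.val.toRingHom).codRestrict RqPlus fun s n => by
    rw [RingHom.comp_apply, eval_C]; exact s.2

/-- Evaluation at `[n]_q` on `R_q^+`. -/
def RqPlus.evalAt (n : ℕ) : RqPlus →+* intPoly :=
  ((evalRingHom (qInt n)).comp RqPlus.subtype).codRestrict intPoly fun P => P.2 n

/-- The inclusion of the constants in `R_q`. -/
def Rq.const : intLaurent →+* Rq :=
  ((C : RatFunc ℚ →+* _).comp intLaurent.val.toRingHom).codRestrict Rq fun s n => by
    rw [RingHom.comp_apply, eval_C]; exact s.2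

/-- Evaluation at `[n]_q` on `R_q`. -/
def Rq.evalAt (n : ℕ) : Rq →+* intLaurent :=
  ((evalRingHom (qInt n)).comp Rq.subtype).codRestrict intLaurent fun P => P.2 n

theorem RqPlus.exists_expansion (P : RqPlus) :
    ∃ c : ℕ →₀ intPoly, P = c.sum fun m s => RqPlus.const s * RqPlus.binom m := by
  obtain ⟨c, hc⟩ := exists_newton_expansion qv_mem_intPoly P.2
  refine ⟨c, Subtype.ext (hc.trans ?_)⟩
  rw [Finsupp.sum, Finsupp.sum, AddSubmonoidClass.coe_finsetSum]
  rfl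

theorem Rq.exists_expansion (P : Rq) :
    ∃ c : ℕ →₀ intLaurent, P = c.sum fun m s => Rq.const s * Rq.binom m := by
  obtain ⟨c, hc⟩ := exists_newton_expansion qv_mem_intLaurent fun n : ℕ => P.2 n
  refine ⟨c, Subtype.ext (hc.trans ?_)⟩
  rw [Finsupp.sum, Finsupp.sum, AddSubmonoidClass.coe_finsetSum]
  rfl

theorem RqPlus.evalAt_const (n : ℕ) (s : intPoly) : RqPlus.evalAt n (RqPlus.const s) = s :=
  Subtype.ext (eval_C (x := qInt n))

theorem Rq.evalAt_const (n : ℕ) (s : intLaurent) : Rq.evalAt n (Rq.const s) = s :=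
  Subtype.ext (eval_C (x := qInt n))

theorem RqPlus.evalAt_binom (n m : ℕ) :
    RqPlus.evalAt n (RqPlus.binom m) = gaussCoeff ⟨qv, qv_mem_intPoly⟩ n m := by
  refine Subtype.ext ((eval_qBinomPoly_qInt n m).trans ?_)
  exact (map_gaussCoeff (⟨qv, qv_mem_intPoly⟩ : intPoly) intPoly.val.toRingHom n m).symm

theorem Rq.evalAt_binom (n m : ℕ) :
    Rq.evalAt n (Rq.binom m) = gaussCoeff ⟨qv, qv_mem_intLaurent⟩ n m := by
  refine Subtype.ext ((eval_qBinomPoly_qInt n m).trans ?_)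
  exact (map_gaussCoeff (⟨qv, qv_mem_intLaurent⟩ : intLaurent) intLaurent.val.toRingHom n m).symm

section homs

variable {k : Type*} [Field k]

theorem RqPlus.mem_polyClosure (φ : RqPlus →+* k) :
    (fun m => φ (RqPlus.binom m)) ∈ polyClosure (gaussCoeff (φ RqPlus.q)) := by
  have h := mem_polyClosure_of_ringHom RqPlus.const RqPlus.binom RqPlus.exists_expansion
    RqPlus.evalAt RqPlus.evalAt_const (φ.comp RqPlus.const)
    (fun n m h => by rw [RqPlus.evalAt_binom, gaussCoeff_eq_zero_of_lt _ h])
    (fun n => by rw [RqPlus.evalAt_binom, gaussCoeff_self]) (φ := φ) (fun _ => rfl)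
  simp only [RqPlus.evalAt_binom, map_gaussCoeff] at h
  exact h

theorem Rq.mem_polyClosure (φ : Rq →+* k) :
    (fun m => φ (Rq.binom m)) ∈ polyClosure (gaussCoeff (φ Rq.q)) := by
  have h := mem_polyClosure_of_ringHom Rq.const Rq.binom Rq.exists_expansion
    Rq.evalAt Rq.evalAt_const (φ.comp Rq.const)
    (fun n m h => by rw [Rq.evalAt_binom, gaussCoeff_eq_zero_of_lt _ h])
    (fun n => by rw [Rq.evalAt_binom, gaussCoeff_self]) (φ := φ) (fun _ => rfl)
  simp only [Rq.evalAt_binom, map_gaussCoeff] at h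
  exact h

theorem RqPlus.existsUnique_ringHom {κ : k} {v : ℕ → k} (hv : v ∈ polyClosure (gaussCoeff κ)) :
    ∃! φ : RqPlus →+* k, φ RqPlus.q = κ ∧ ∀ m, φ (RqPlus.binom m) = v m := by
  obtain ⟨g, rfl⟩ := exists_ringHom_intPoly κ
  obtain ⟨φ, hφ, hv'⟩ := exists_ringHom_of_mem_polyClosure RqPlus.const RqPlus.binom
    RqPlus.exists_expansion RqPlus.evalAt RqPlus.evalAt_const g (v := v) (by
      simp only [RqPlus.evalAt_binom, map_gaussCoeff]; exact hv)
  refine ⟨φ, ⟨hφ ⟨qv, qv_mem_intPoly⟩, hv'⟩, fun ψ hψ => ?_⟩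
  refine ringHom_ext_of_span RqPlus.const RqPlus.binom RqPlus.exists_expansion
    (fun s => ?_) fun m => (hψ.2 m).trans (hv' m).symm
  have : ψ.comp RqPlus.const = g := ringHom_intPoly_ext hψ.1
  rw [hφ, ← this]
  rfl

theorem Rq.existsUnique_ringHom {κ : k} (hκ : κ ≠ 0) {v : ℕ → k}
    (hv : v ∈ polyClosure (gaussCoeff κ)) :
    ∃! φ : Rq →+* k, φ Rq.q = κ ∧ ∀ m, φ (Rq.binom m) = v m := by
  obtain ⟨g, rfl⟩ := exists_ringHom_intLaurent hκ
  obtain ⟨φ, hφ, hv'⟩ := exists_ringHom_of_mem_polyClosure Rq.const Rq.binom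
    Rq.exists_expansion Rq.evalAt Rq.evalAt_const g (v := v) (by
      simp only [Rq.evalAt_binom, map_gaussCoeff]; exact hv)
  refine ⟨φ, ⟨hφ ⟨qv, qv_mem_intLaurent⟩, hv'⟩, fun ψ hψ => ?_⟩
  refine ringHom_ext_of_span Rq.const Rq.binom Rq.exists_expansion
    (fun s => ?_) fun m => (hψ.2 m).trans (hv' m).symm
  have : ψ.comp Rq.const = g := ringHom_intLaurent_ext hψ.1
  rw [hφ, ← this]
  rfl

theorem Rq.map_q_ne_zero (φ : Rq →+* k) : φ Rq.q ≠ 0 :=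
  left_ne_zero_of_mul_eq_one (map_intLaurent_qv_mul_inv (φ.comp Rq.const))

end homs

/-! ### Points of the closure -/

section polyClosure

variable {ι k : Type*} [Field k] {b : ι → ℕ → k} {v : ℕ → k}

theorem eval_eq_eval_of_mem_polyClosure (hv : v ∈ polyClosure b) {F G : MvPolynomial ℕ k}
    (h : ∀ i, MvPolynomial.eval (b i) F = MvPolynomial.eval (b i) G) :
    MvPolynomial.eval v F = MvPolynomial.eval v G := by
  rw [← sub_eq_zero, ← map_sub]
  exact hv _ fun i => by rw [map_sub, h, sub_self]

theorem polyClosure_comp_subset {κ : Type*} (f : κ → ι) : polyClosure (b ∘ f) ⊆ polyClosure b :=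
  fun _ hv F hF => hv F fun i => hF (f i)

theorem polyClosure_substitute (hv : v ∈ polyClosure b) (σ : ℕ → MvPolynomial ℕ k) :
    (fun m => MvPolynomial.eval v (σ m)) ∈ polyClosure fun i m => MvPolynomial.eval (b i) (σ m) := by
  have h : ∀ (u : ℕ → k) F, MvPolynomial.eval (fun m => MvPolynomial.eval u (σ m)) F =
      MvPolynomial.eval u (MvPolynomial.bind₁ σ F) := by
    intro u F
    induction F using MvPolynomial.induction_on with
    | C a => simp
    | add F G hF hG => simp [hF, hG]
    | mul_X F j hF => simp [hF]
  intro F hF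
  rw [h]
  exact hv _ fun i => by rw [← h]; exact hF i

theorem mem_polyClosure_of_approx (h : ∀ M, ∃ i, ∀ m < M, b i m = v m) : v ∈ polyClosure b := by
  intro F hF
  obtain ⟨i, hi⟩ := h (F.vars.sup id + 1)
  rw [← hF i]
  refine MvPolynomial.eval₂Hom_congr' rfl (fun m hm _ => ?_) rfl
  exact (hi m (Nat.lt_succ_of_le (Finset.le_sup (f := id) hm))).symm

theorem mem_polyClosure_of_polynomial_family (f : ℕ → k[X]) (s : ι → k)
    (hs : (Set.range s).Infinite) (h : ∀ i m, (f m).eval (s i) = b i m) (t : k) :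
    (fun m => (f m).eval t) ∈ polyClosure b := by
  have key : ∀ (t : k) F, MvPolynomial.eval (fun m => (f m).eval t) F =
      (MvPolynomial.aeval f F).eval t := by
    intro t F
    induction F using MvPolynomial.induction_on with
    | C a => simp
    | add F G hF hG => simp [hF, hG]
    | mul_X F j hF => simp [hF]
  intro F hF
  rw [key, eq_zero_of_infinite_isRoot (MvPolynomial.aeval f F), eval_zero]
  refine hs.mono ?_
  rintro _ ⟨i, rfl⟩
  rw [Set.mem_ofPred_eq, IsRoot, ← key]
  simpa only [h] using hF i

/-- If finitely many patterns occur among the first `M` coordinates, then a limit point has one of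
these patterns. -/
theorem exists_pattern_of_mem_polyClosure (hv : v ∈ polyClosure b) {M J : ℕ} {c : ℕ → ℕ → k}
    (h : ∀ i, ∃ j < J, ∀ m < M, b i m = c j m) : ∃ j < J, ∀ m < M, v m = c j m := by
  by_contra! hcon
  have : ∀ j, ∃ m, j < J → m < M ∧ v m ≠ c j m := by
    intro j
    by_cases hj : j < J
    · obtain ⟨m, hm⟩ := hcon j hj
      exact ⟨m, fun _ => hm⟩
    · exact ⟨0, fun h => absurd h hj⟩
  choose μ hμ using this
  have h0 := hv (∏ j ∈ Finset.range J, (MvPolynomial.X (μ j) - MvPolynomial.C (c j (μ j))))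
    fun i => by
      obtain ⟨j, hj, hm⟩ := h i
      rw [map_prod]
      refine Finset.prod_eq_zero (Finset.mem_range.mpr hj) ?_
      rw [map_sub, MvPolynomial.eval_X, MvPolynomial.eval_C, hm _ (hμ j hj).1, sub_self]
  rw [map_prod, Finset.prod_eq_zero_iff] at h0
  obtain ⟨j, hj, h0⟩ := h0
  rw [map_sub, MvPolynomial.eval_X, MvPolynomial.eval_C, sub_eq_zero] at h0
  exact (hμ j (Finset.mem_range.mp hj)).2 h0

end polyClosure

/-! ### Identities for Gaussian binomial coefficients over a field -/

section identities

variable {k : Type*} [Field k] (κ : k)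

theorem qFactorial_succ (n : ℕ) : qFactorial κ (n + 1) = qFactorial κ n * qNum κ (n + 1) :=
  Finset.prod_range_succ _ _

@[simp] theorem qNum_zero : qNum κ 0 = 0 := rfl

@[simp] theorem qFactorial_zero : qFactorial κ 0 = 1 := rfl

theorem qNum_add (a b : ℕ) : qNum κ (a + b) = qNum κ b + κ ^ b * qNum κ a := by
  rw [add_comm, qNum, Finset.sum_range_add, qNum, qNum, Finset.mul_sum]
  simp only [pow_add]

theorem qNum_ne_zero {n : ℕ} (h : κ ^ n ≠ 1) : qNum κ n ≠ 0 := by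
  intro h0
  have := geom_sum_mul κ n
  rw [show ∑ i ∈ Finset.range n, κ ^ i = 0 from h0, zero_mul] at this
  exact h (sub_eq_zero.mp this.symm)

theorem qFactorial_ne_zero {n : ℕ} (h : ∀ i, 0 < i → i ≤ n → κ ^ i ≠ 1) : qFactorial κ n ≠ 0 :=
  Finset.prod_ne_zero_iff.mpr fun i hi =>
    qNum_ne_zero κ (h _ i.succ_pos (Finset.mem_range.mp hi))

theorem gaussCoeff_one_right (n : ℕ) : gaussCoeff κ n 1 = qNum κ n := by
  induction n with
  | zero => rfl
  | succ n ih => rw [gaussCoeff_succ_succ, ih, gaussCoeff_zero_right, qNum_succ, zero_add, pow_one]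

theorem gaussCoeff_mul_eq_prod (n m : ℕ) :
    gaussCoeff κ n m * (κ ^ m.choose 2 * qFactorial κ m) =
      ∏ i ∈ Finset.range m, (qNum κ n - qNum κ i) := by
  induction n generalizing m with
  | zero =>
    cases m with
    | zero => simp
    | succ m =>
      rw [gaussCoeff_zero_succ, zero_mul, Finset.prod_range_succ']
      simp
  | succ n ih =>
    cases m with
    | zero => simp
    | succ m =>
      have hP : ∏ i ∈ Finset.range (m + 1), (qNum κ (n + 1) - qNum κ i) =
          κ ^ m * (∏ i ∈ Finset.range m, (qNum κ n - qNum κ i)) * (κ * qNum κ n + 1) := by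
        rw [Finset.prod_range_succ']
        have h : ∀ i ∈ Finset.range m,
            qNum κ (n + 1) - qNum κ (i + 1) = κ * (qNum κ n - qNum κ i) := by
          intro i _
          rw [qNum_succ, qNum_succ]; ring
        rw [Finset.prod_congr rfl h, Finset.prod_mul_distrib, Finset.prod_const, Finset.card_range,
          qNum_succ, qNum_zero, sub_zero]
      have hC : (m + 1).choose 2 = m + m.choose 2 := by
        rw [Nat.choose_succ_succ' m 1, Nat.choose_one_right]
      have h1 := ih (m + 1)
      have h2 := ih m
      rw [Finset.prod_range_succ, ← h2] at h1
      rw [hP, ← h2, gaussCoeff_succ_succ, add_mul, mul_assoc (κ ^ (m + 1)), h1, hC, qFactorial_succ,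
        qNum_succ κ m, pow_add]
      ring

theorem gaussCoeff_mul_qFactorial (a b : ℕ) :
    gaussCoeff κ (a + b) b * (qFactorial κ a * qFactorial κ b) = qFactorial κ (a + b) := by
  induction a generalizing b with
  | zero => simp
  | succ a iha =>
    induction b with
    | zero => simp
    | succ b ihb =>
      have h1 := iha (b + 1)
      have h3 := qNum_add κ (a + 1) (b + 1)
      rw [show a + 1 + (b + 1) = a + 1 + b + 1 by ring] at h3 ⊢
      rw [show a + (b + 1) = a + 1 + b by ring] at h1
      rw [gaussCoeff_succ_succ, qFactorial_succ κ (a + 1 + b), h3]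
      rw [qFactorial_succ κ b] at h1 ⊢
      rw [qFactorial_succ κ a] at ihb ⊢
      linear_combination κ ^ (b + 1) * qNum κ (a + 1) * h1 + qNum κ (b + 1) * ihb

theorem qBinom_eq_gaussCoeff {n : ℕ} (h : ∀ i, 0 < i → i ≤ n → κ ^ i ≠ 1) (m : ℕ) :
    qBinom κ n m = gaussCoeff κ n m := by
  rw [qBinom]
  split_ifs with hm
  · obtain ⟨a, rfl⟩ := Nat.exists_eq_add_of_le' hm
    rw [Nat.add_sub_cancel, ← gaussCoeff_mul_qFactorial, mul_div_assoc, div_self, mul_one]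
    exact mul_ne_zero (qFactorial_ne_zero κ fun i h0 hi => h i h0 (by omega))
      (qFactorial_ne_zero κ fun i h0 hi => h i h0 (by omega))
  · exact (gaussCoeff_eq_zero_of_lt κ (by omega)).symm

theorem eval_qBinomPoly_mul {m : ℕ} (h : κ ^ m.choose 2 * qFactorial κ m ≠ 0) (t : k) :
    (qBinomPoly κ m).eval t * (κ ^ m.choose 2 * qFactorial κ m) =
      ∏ i ∈ Finset.range m, (t - qNum κ i) := by
  rw [qBinomPoly, eval_mul, eval_C, eval_prod, mul_comm, mul_inv_cancel_left₀ h]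
  simp

/-- Two rows of a triangular array that agree up to a bound on their indices are equal. -/
theorem gaussCoeff_row_injective {M a b : ℕ} (ha : a < M) (hb : b < M)
    (h : ∀ m < M, gaussCoeff κ a m = gaussCoeff κ b m) : a = b := by
  by_contra hne
  rcases lt_or_gt_of_ne hne with hlt | hlt
  · have := h b hb
    rw [gaussCoeff_eq_zero_of_lt κ hlt, gaussCoeff_self] at this
    exact zero_ne_one this
  · have := h a ha
    rw [gaussCoeff_eq_zero_of_lt κ hlt, gaussCoeff_self] at this
    exact one_ne_zero this

/-! ### The closure at `κ = 0` -/

theorem step_mem_polyClosure (N : ℕ∞) :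
    (fun m : ℕ => if (m : ℕ∞) ≤ N then (1 : k) else 0) ∈ polyClosure (gaussCoeff (0 : k)) := by
  refine mem_polyClosure_of_approx fun M => ?_
  cases N with
  | top => exact ⟨M, fun m hm => by simp [gaussCoeff_zero_left, hm.le]⟩
  | coe N => exact ⟨N, fun m _ => by simp [gaussCoeff_zero_left]⟩

theorem existsUnique_step {v : ℕ → k} (hv : v ∈ polyClosure (gaussCoeff (0 : k))) :
    ∃! N : ℕ∞, ∀ m : ℕ, v m = if (m : ℕ∞) ≤ N then 1 else 0 := by
  have hmul : ∀ a b, a ≤ b → v a * v b = v b := by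
    intro a b hab
    have := eval_eq_eval_of_mem_polyClosure hv
      (F := MvPolynomial.X a * MvPolynomial.X b) (G := MvPolynomial.X b) fun n => by
        simp only [map_mul, MvPolynomial.eval_X, gaussCoeff_zero_left]
        split_ifs <;> first | omega | simp
    simpa using this
  have hv0 : v 0 = 1 := by
    have := eval_eq_eval_of_mem_polyClosure hv (F := MvPolynomial.X 0) (G := 1) fun n => by simp
    simpa using this
  have hor : ∀ m, v m ≠ 0 → v m = 1 := fun m hm => mul_left_cancel₀ hm (by
    rw [hmul m m le_rfl, mul_one])
  refine existsUnique_of_exists_of_unique ?_ ?_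
  · by_cases h : ∃ m, v m = 0
    · classical
      have hne : Nat.find h ≠ 0 := fun h0 => by
        have := Nat.find_spec h
        rw [h0, hv0] at this
        exact one_ne_zero this
      refine ⟨(Nat.find h - 1 : ℕ), fun m => ?_⟩
      split_ifs with hm <;> rw [Nat.cast_le] at hm
      · exact hor m (Nat.find_min h (by omega))
      · rw [← hmul (Nat.find h) m (by omega), Nat.find_spec h, zero_mul]
    · push Not at h
      exact ⟨⊤, fun m => by simpa using hor m (h m)⟩
  · intro N N' hN hN'
    refine ENat.eq_of_forall_natCast_le_iff fun m => ?_
    have := (hN m).symm.trans (hN' m)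
    constructor <;> intro h1 <;> by_contra h2
    · rw [if_pos h1, if_neg h2] at this
      exact one_ne_zero this
    · rw [if_neg h2, if_pos h1] at this
      exact zero_ne_one this

/-! ### The closure at elements that are not roots of unity -/

variable {κ}

theorem qNum_injective (h0 : κ ≠ 0) (h : ∀ n : ℕ, 0 < n → κ ^ n ≠ 1) :
    Function.Injective (qNum κ) := by
  have key : ∀ a b, 0 < a → qNum κ (a + b) ≠ qNum κ b := fun a b ha hab => by
    rw [qNum_add, add_eq_left] at hab
    exact mul_ne_zero (pow_ne_zero _ h0) (qNum_ne_zero κ (h a ha)) hab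
  intro a b hab
  by_contra hne
  rcases lt_or_gt_of_ne hne with hlt | hlt
  · exact key (b - a) a (by omega) (by rw [Nat.sub_add_cancel hlt.le, hab])
  · exact key (a - b) b (by omega) (by rw [Nat.sub_add_cancel hlt.le, hab])

theorem denominator_ne_zero (h0 : κ ≠ 0) (h : ∀ n : ℕ, 0 < n → κ ^ n ≠ 1) (m : ℕ) :
    κ ^ m.choose 2 * qFactorial κ m ≠ 0 :=
  mul_ne_zero (pow_ne_zero _ h0) (qFactorial_ne_zero κ fun i hi _ => h i hi)

theorem eval_qBinomPoly_mem_polyClosure (h0 : κ ≠ 0) (h : ∀ n : ℕ, 0 < n → κ ^ n ≠ 1) (t : k) :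
    (fun m => (qBinomPoly κ m).eval t) ∈ polyClosure (gaussCoeff κ) := by
  refine mem_polyClosure_of_polynomial_family (qBinomPoly κ) (qNum κ)
    (Set.infinite_range_of_injective (qNum_injective h0 h)) (fun n m => ?_) t
  have hm := denominator_ne_zero h0 h m
  refine mul_right_cancel₀ hm ?_
  rw [eval_qBinomPoly_mul κ hm, gaussCoeff_mul_eq_prod]

theorem existsUnique_eval_qBinomPoly (h0 : κ ≠ 0) (h : ∀ n : ℕ, 0 < n → κ ^ n ≠ 1) {v : ℕ → k}
    (hv : v ∈ polyClosure (gaussCoeff κ)) : ∃! t : k, ∀ m, v m = (qBinomPoly κ m).eval t := by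
  refine ⟨v 1, fun m => ?_, fun t ht => ?_⟩
  · have hm := denominator_ne_zero h0 h m
    refine mul_right_cancel₀ hm ?_
    rw [eval_qBinomPoly_mul κ hm]
    have := eval_eq_eval_of_mem_polyClosure hv
      (F := MvPolynomial.X m * MvPolynomial.C (κ ^ m.choose 2 * qFactorial κ m))
      (G := ∏ i ∈ Finset.range m, (MvPolynomial.X 1 - MvPolynomial.C (qNum κ i))) fun n => by
        simp only [map_prod, map_sub, MvPolynomial.eval_C, MvPolynomial.eval_X,
          gaussCoeff_one_right, ← gaussCoeff_mul_eq_prod]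
        simp
    simpa using this
  · have h1 := eval_qBinomPoly_mul κ (denominator_ne_zero h0 h 1) t
    rw [← ht 1] at h1
    simpa [qFactorial_succ, qNum_succ] using h1.symm

end identities

/-! ### The closure at roots of unity -/

section rootsOfUnity

variable {k : Type*} [Field k] {ω : k} {d : ℕ}

theorem gaussCoeff_primitiveRoot_eq_zero (hω : IsPrimitiveRoot ω d) {j : ℕ} (h0 : 0 < j)
    (hj : j < d) : gaussCoeff ω d j = 0 := by
  have hne : ω ^ j.choose 2 * qFactorial ω j ≠ 0 :=
    mul_ne_zero (pow_ne_zero _ (hω.ne_zero (by omega)))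
      (qFactorial_ne_zero ω fun i hi hij => hω.pow_ne_one_of_pos_of_lt hi.ne' (by omega))
  refine (mul_eq_zero_iff_right hne).mp ?_
  rw [gaussCoeff_mul_eq_prod]
  refine Finset.prod_eq_zero (Finset.mem_range.mpr h0) ?_
  rw [qNum_zero, sub_zero]
  exact hω.geom_sum_eq_zero (by omega)

theorem succ_div_mod_of_lt {n d : ℕ} (h : n % d + 1 < d) :
    (n + 1) / d = n / d ∧ (n + 1) % d = n % d + 1 := by
  rw [Nat.div_mod_unique (by omega)]
  have := Nat.mod_add_div n d
  exact ⟨by omega, h⟩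

theorem succ_div_mod_of_eq {n d : ℕ} (h : n % d + 1 = d) :
    (n + 1) / d = n / d + 1 ∧ (n + 1) % d = 0 := by
  rw [Nat.div_mod_unique (by omega), mul_add]
  have := Nat.mod_add_div n d
  exact ⟨by omega, by omega⟩

/-- The `q`-analogue of Lucas's theorem. -/
theorem gaussCoeff_primitiveRoot (hd : 0 < d) (hω : IsPrimitiveRoot ω d) (n m : ℕ) :
    gaussCoeff ω n m = ((n / d).choose (m / d) : k) * gaussCoeff ω (n % d) (m % d) := by
  induction n generalizing m with
  | zero =>
    rw [Nat.zero_div, Nat.zero_mod]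
    cases hm : m % d with
    | zero =>
      cases hm' : m / d with
      | zero =>
        have := Nat.mod_add_div m d
        rw [hm, hm'] at this
        simp [← this]
      | succ l =>
        rw [gaussCoeff_eq_zero_of_lt ω (Nat.pos_of_ne_zero _)]
        · simp
        · rintro rfl
          simp at hm'
    | succ l =>
      rw [gaussCoeff_eq_zero_of_lt ω (Nat.pos_of_ne_zero _)]
      · simp
      · rintro rfl
        simp at hm
  | succ n ih =>
    cases m with
    | zero => simp
    | succ m =>
      have hpow : ω ^ (m + 1) = ω ^ (m % d + 1) := by
        conv_lhs => rw [← Nat.mod_add_div m d]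
        rw [pow_succ, pow_add, pow_mul, hω.pow_eq_one, one_pow, mul_one, pow_succ]
      rw [gaussCoeff_succ_succ, ih, ih, hpow]
      have hn0 := Nat.mod_lt n hd
      have hm0 := Nat.mod_lt m hd
      rcases (Nat.succ_le_of_lt hn0).lt_or_eq with hn | hn <;>
      rcases (Nat.succ_le_of_lt hm0).lt_or_eq with hm | hm
      · rw [(succ_div_mod_of_lt hn).1, (succ_div_mod_of_lt hn).2, (succ_div_mod_of_lt hm).1,
          (succ_div_mod_of_lt hm).2, gaussCoeff_succ_succ]
        ring
      · rw [(succ_div_mod_of_lt hn).1, (succ_div_mod_of_lt hn).2, (succ_div_mod_of_eq hm).1,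
          (succ_div_mod_of_eq hm).2, gaussCoeff_zero_right, gaussCoeff_zero_right,
          gaussCoeff_eq_zero_of_lt ω (show n % d < m % d by omega),
          show m % d + 1 = d from hm, hω.pow_eq_one]
        ring
      · have h0 := gaussCoeff_primitiveRoot_eq_zero hω (Nat.succ_pos (m % d)) hm
        nth_rw 1 [← hn] at h0
        rw [Nat.succ_eq_add_one, Nat.succ_eq_add_one, gaussCoeff_succ_succ] at h0
        rw [(succ_div_mod_of_eq hn).1, (succ_div_mod_of_eq hn).2, (succ_div_mod_of_lt hm).1,
          (succ_div_mod_of_lt hm).2, gaussCoeff_zero_succ]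
        linear_combination ((n / d).choose (m / d) : k) * h0
      · rw [(succ_div_mod_of_eq hn).1, (succ_div_mod_of_eq hn).2, (succ_div_mod_of_eq hm).1,
          (succ_div_mod_of_eq hm).2, gaussCoeff_zero_right, gaussCoeff_zero_right,
          show m % d = n % d by omega, gaussCoeff_self, show n % d + 1 = d from hn, hω.pow_eq_one,
          Nat.choose_succ_succ', Nat.cast_add]
        ring

theorem mem_polyClosure_of_primitiveRoot (hd : 0 < d) (hω : IsPrimitiveRoot ω d) {n₀ : ℕ}
    (hn₀ : n₀ < d) {w : ℕ → k} (hw : w ∈ polyClosure fun n m : ℕ => (n.choose m : k)) :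
    (fun m => w (m / d) * gaussCoeff ω n₀ (m % d)) ∈ polyClosure (gaussCoeff ω) := by
  have h := polyClosure_substitute hw fun m =>
    MvPolynomial.X (m / d) * MvPolynomial.C (gaussCoeff ω n₀ (m % d))
  simp only [map_mul, MvPolynomial.eval_X, MvPolynomial.eval_C] at h
  refine polyClosure_comp_subset (fun n => d * n + n₀) ?_
  refine (congrArg (_ ∈ polyClosure ·) (funext₂ fun n m => ?_)).mp h
  rw [Function.comp_apply, gaussCoeff_primitiveRoot hd hω (d * n + n₀), Nat.mul_add_mod,
    Nat.mod_eq_of_lt hn₀, Nat.mul_add_div hd, Nat.div_eq_of_lt hn₀, add_zero]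

theorem exists_of_mem_polyClosure_primitiveRoot (hd : 0 < d) (hω : IsPrimitiveRoot ω d)
    {v : ℕ → k} (hv : v ∈ polyClosure (gaussCoeff ω)) :
    ∃ n₀ < d, ∃ w ∈ polyClosure fun n m : ℕ => (n.choose m : k),
      ∀ m, v m = w (m / d) * gaussCoeff ω n₀ (m % d) := by
  obtain ⟨n₀, hn₀, h⟩ := exists_pattern_of_mem_polyClosure hv (M := d) (J := d)
    (c := gaussCoeff ω) fun n => ⟨n % d, Nat.mod_lt n hd, fun m hm => by
      rw [gaussCoeff_primitiveRoot hd hω n m, Nat.div_eq_of_lt hm, Nat.mod_eq_of_lt hm]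
      simp⟩
  refine ⟨n₀, hn₀, fun m => v (d * m), ?_, fun m => ?_⟩
  · have h := polyClosure_substitute hv fun m => MvPolynomial.X (d * m)
    simp only [MvPolynomial.eval_X] at h
    refine polyClosure_comp_subset (fun n => n / d) ?_
    refine (congrArg (_ ∈ polyClosure ·) (funext₂ fun n m => ?_)).mp h
    rw [Function.comp_apply, gaussCoeff_primitiveRoot hd hω n, Nat.mul_div_cancel_left _ hd,
      Nat.mul_mod_right, gaussCoeff_zero_right, mul_one]
  · rw [← h _ (Nat.mod_lt m hd)]
    have := eval_eq_eval_of_mem_polyClosure hv (F := MvPolynomial.X m)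
      (G := MvPolynomial.X (d * (m / d)) * MvPolynomial.X (m % d)) fun n => by
        simp only [map_mul, MvPolynomial.eval_X]
        rw [gaussCoeff_primitiveRoot hd hω n m, gaussCoeff_primitiveRoot hd hω n (d * (m / d)),
          gaussCoeff_primitiveRoot hd hω n (m % d), Nat.mul_div_cancel_left _ hd,
          Nat.mul_mod_right, Nat.div_eq_of_lt (Nat.mod_lt m hd), Nat.mod_mod]
        simp
    simpa using this

end rootsOfUnity

/-! ### Limits of binomial coefficients in characteristic zero -/

section charZero

variable {k : Type*} [Field k]

theorem prod_sub_natCast_eq (n m : ℕ) :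
    ∏ i ∈ Finset.range m, ((n : k) - (i : k)) = (m.factorial : k) * (n.choose m : k) := by
  rw [← Nat.cast_mul, ← Nat.descFactorial_eq_factorial_mul_choose,
    ← descPochhammer_eval_eq_descFactorial, descPochhammer_eval_eq_prod_range]

theorem binomZero_one (s : k) : binomZero s 1 = s := by simp [binomZero]

variable [CharZero k]

theorem binomZero_mem_polyClosure (s : k) :
    binomZero s ∈ polyClosure fun n m : ℕ => (n.choose m : k) := by
  have h := mem_polyClosure_of_polynomial_family (b := fun n m : ℕ => (n.choose m : k))
    (fun m => C (m.factorial : k)⁻¹ * ∏ i ∈ Finset.range m, (X - C (i : k))) (fun n : ℕ => (n : k))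
    (Set.infinite_range_of_injective Nat.cast_injective) (fun n m => by
      have hm : (m.factorial : k) ≠ 0 := Nat.cast_ne_zero.mpr m.factorial_ne_zero
      rw [eval_mul, eval_prod, eval_C, ← inv_mul_cancel_left₀ hm (n.choose m : k),
        ← prod_sub_natCast_eq]
      simp) s
  convert h using 2 with m
  rw [binomZero, eval_mul, eval_prod, eval_C, div_eq_inv_mul]
  simp

theorem exists_binomZero {w : ℕ → k} (hw : w ∈ polyClosure fun n m : ℕ => (n.choose m : k)) :
    ∃ s : k, w = binomZero s := by
  refine ⟨w 1, funext fun m => ?_⟩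
  have hm : (m.factorial : k) ≠ 0 := Nat.cast_ne_zero.mpr m.factorial_ne_zero
  rw [binomZero, eq_div_iff hm]
  have := eval_eq_eval_of_mem_polyClosure hw
    (F := MvPolynomial.X m * MvPolynomial.C (m.factorial : k))
    (G := ∏ i ∈ Finset.range m, (MvPolynomial.X 1 - MvPolynomial.C (i : k))) fun n => by
      simp only [map_prod, map_sub, map_mul, MvPolynomial.eval_C, MvPolynomial.eval_X,
        Nat.choose_one_right, prod_sub_natCast_eq]
      ring
  simpa using this

end charZero

/-! ### Limits of binomial coefficients in positive characteristic -/

section charP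

variable (k : Type*) [Field k] {p : ℕ} [Fact p.Prime]

theorem cast_choose_eq_prod [CharP k p] {M m : ℕ} (n : ℕ) (hm : m < p ^ M) :
    (n.choose m : k) = ∏ i ∈ Finset.range M, ((n / p ^ i % p).choose (m / p ^ i % p) : k) := by
  have h := Choose.choose_modEq_choose_mul_prod_range_choose (n := n) (k := m) (p := p) M
  rw [Nat.div_eq_of_lt hm, Nat.choose_zero_right, Nat.cast_one, one_mul] at h
  have := (CharP.intCast_eq_intCast k p).mpr h
  push_cast at this
  exact this

theorem mod_pow_div_pow_mod {p : ℕ} (n : ℕ) {i M : ℕ} (hi : i < M) :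
    n % p ^ M / p ^ i % p = n / p ^ i % p := by
  rw [show p ^ M = p ^ i * p ^ (M - i) by rw [← pow_add, Nat.add_sub_cancel' hi.le],
    Nat.mod_mul_right_div_self, Nat.mod_mod_of_dvd]
  exact dvd_pow_self p (by omega)

theorem cast_choose_mod_pow [CharP k p] {M m : ℕ} (n : ℕ) (hm : m < p ^ M) :
    ((n % p ^ M).choose m : k) = (n.choose m : k) := by
  rw [cast_choose_eq_prod k n hm, cast_choose_eq_prod k _ hm]
  refine Finset.prod_congr rfl fun i hi => ?_
  rw [mod_pow_div_pow_mod n (Finset.mem_range.mp hi)]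

theorem val_toZModPow_mod (s : ℤ_[p]) {a b : ℕ} (h : a ≤ b) :
    (PadicInt.toZModPow b s).val % p ^ a = (PadicInt.toZModPow a s).val := by
  rw [← PadicInt.cast_toZModPow a b h s, ← ZMod.natCast_val, ZMod.val_natCast]

theorem padicDigit_eq (s : ℤ_[p]) {i M : ℕ} (hi : i < M) :
    padicDigit s i = (PadicInt.toZModPow M s).val / p ^ i % p := by
  rw [padicDigit, ← val_toZModPow_mod s (Nat.succ_le_of_lt hi),
    ← mod_pow_div_pow_mod _ i.lt_succ_self]
  refine (Nat.mod_eq_of_lt ?_).symm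
  rw [Nat.div_lt_iff_lt_mul (pow_pos (Fact.out : p.Prime).pos i), ← pow_succ']
  exact Nat.mod_lt _ (pow_pos (Fact.out : p.Prime).pos _)

theorem binomPadic_eq_choose [CharP k p] (s : ℤ_[p]) {m M : ℕ} (hm : m < p ^ M) :
    binomPadic k s m = ((PadicInt.toZModPow M s).val.choose m : k) := by
  rw [← val_toZModPow_mod s (Nat.le_add_right M (m + 1)), cast_choose_mod_pow k _ hm, binomPadic,
    cast_choose_eq_prod k _ (m.lt_succ_self.trans (Nat.lt_pow_self (Fact.out : p.Prime).one_lt))]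
  refine Finset.prod_congr rfl fun i hi => ?_
  rw [padicDigit_eq s (M := M + (m + 1)) (by have := Finset.mem_range.mp hi; omega)]

theorem binomPadic_mem_polyClosure [CharP k p] (s : ℤ_[p]) :
    binomPadic k s ∈ polyClosure fun n m : ℕ => (n.choose m : k) :=
  mem_polyClosure_of_approx fun M => ⟨(PadicInt.toZModPow M s).val, fun _ hm =>
    (binomPadic_eq_choose k s (hm.trans (Nat.lt_pow_self (Fact.out : p.Prime).one_lt))).symm⟩

theorem choose_row_injective {M a b : ℕ} (ha : a < M) (hb : b < M)
    (h : ∀ m < M, (a.choose m : k) = (b.choose m : k)) : a = b :=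
  gaussCoeff_row_injective (1 : k) ha hb fun m hm => by
    rw [gaussCoeff_one_eq_choose, gaussCoeff_one_eq_choose, h m hm]

theorem val_toZModPow_lt (s : ℤ_[p]) (M : ℕ) : (PadicInt.toZModPow M s).val < p ^ M :=
  ZMod.val_lt _

theorem binomPadic_injective [CharP k p] :
    Function.Injective (binomPadic k : ℤ_[p] → ℕ → k) := by
  intro s s' h
  refine PadicInt.ext_of_toZModPow.mp fun M => ZMod.val_injective _ ?_
  refine choose_row_injective k (val_toZModPow_lt s M) (val_toZModPow_lt s' M) fun m hm => ?_
  rw [← binomPadic_eq_choose k s hm, ← binomPadic_eq_choose k s' hm, h]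

/-- A compatible system of residues comes from a `p`-adic integer. -/
theorem exists_toZModPow_eq (f : ℕ → ℕ) (hf : ∀ a b, a ≤ b → f b % p ^ a = f a) :
    ∃ s : ℤ_[p], ∀ M, PadicInt.toZModPow M s = f M := by
  have hI : ∀ n (x y : ℤ_[p]), x ≡ y [SMOD (IsLocalRing.maximalIdeal ℤ_[p] ^ n •
      ⊤ : Submodule ℤ_[p] ℤ_[p])] ↔ PadicInt.toZModPow n x = PadicInt.toZModPow n y := by
    intro n x y
    rw [SModEq.sub_mem, smul_eq_mul, Ideal.mul_top, PadicInt.maximalIdeal_eq_span_p,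
      Ideal.span_singleton_pow, ← PadicInt.ker_toZModPow, RingHom.mem_ker, map_sub, sub_eq_zero]
  obtain ⟨s, hs⟩ := IsPrecomplete.prec' (I := IsLocalRing.maximalIdeal ℤ_[p])
    (fun n => (f n : ℤ_[p])) fun {a b} hab => by
      rw [hI, map_natCast, map_natCast, ← hf a b hab, ZMod.natCast_mod]
  refine ⟨s, fun M => ?_⟩
  rw [← (hI M _ _).mp (hs M), map_natCast]

theorem exists_binomPadic [CharP k p] {w : ℕ → k}
    (hw : w ∈ polyClosure fun n m : ℕ => (n.choose m : k)) :
    ∃ s : ℤ_[p], w = binomPadic k s := by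
  have hp := (Fact.out : p.Prime)
  have key : ∀ M, ∃ n < p ^ M, ∀ m < p ^ M, w m = (n.choose m : k) := fun M =>
    exists_pattern_of_mem_polyClosure hw (c := fun n m : ℕ => (n.choose m : k)) fun n =>
      ⟨n % p ^ M, Nat.mod_lt _ (pow_pos hp.pos M), fun m hm => (cast_choose_mod_pow k n hm).symm⟩
  choose f hflt hf using key
  obtain ⟨s, hs⟩ := exists_toZModPow_eq (p := p) f fun a b hab => by
    refine choose_row_injective k (Nat.mod_lt _ (pow_pos hp.pos a)) (hflt a) fun m hm => ?_
    rw [cast_choose_mod_pow k _ hm, ← hf a m hm,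
      hf b m (hm.trans_le (Nat.pow_le_pow_right hp.pos hab))]
  refine ⟨s, funext fun m => ?_⟩
  have hm : m < p ^ m := Nat.lt_pow_self hp.one_lt
  rw [binomPadic_eq_choose k s hm, hs, ZMod.val_natCast, Nat.mod_eq_of_lt (hflt m), hf m m hm]

variable {k}

theorem not_dvd_of_isPrimitiveRoot [CharP k p] {ω : k} {d : ℕ} (hd : 0 < d)
    (hω : IsPrimitiveRoot ω d) : ¬p ∣ d := by
  rintro ⟨e, rfl⟩
  have hp := (Fact.out : p.Prime)
  have h1 := hω.pow_eq_one
  rw [mul_comm, pow_mul] at h1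
  have h2 : ω ^ e = 1 := frobenius_inj k p (by rw [frobenius_def, h1, map_one])
  have he : 0 < e := Nat.pos_of_mul_pos_left hd
  have := Nat.le_of_dvd he (hω.dvd_of_pow_eq_one e h2)
  nlinarith [hp.two_le]

theorem isUnit_natCast_padicInt {d : ℕ} (h : ¬p ∣ d) : IsUnit (d : ℤ_[p]) := by
  rw [PadicInt.isUnit_iff]
  exact PadicInt.norm_natCast_eq_one_iff.mpr ((Nat.Prime.coprime_iff_not_dvd Fact.out).mpr h)

theorem padicShift_bijective {d : ℕ} (h : ¬p ∣ d) (n : ℕ) :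
    Function.Bijective (padicShift d n : ℤ_[p] → ℤ_[p]) := by
  have hu := isUnit_natCast_padicInt h
  constructor
  · intro t t' htt
    have := congrArg (· * (d : ℤ_[p])) htt
    simp only [padicShift, mul_assoc, Ring.inverse_mul_cancel _ hu, mul_one] at this
    exact sub_left_injective this
  · intro s
    exact ⟨s * d + n, by rw [padicShift, add_sub_cancel_right, mul_assoc,
      Ring.mul_inverse_cancel _ hu, mul_one]⟩

end charP

/-! ### Parameters of the limits at roots of unity -/

section parameters

variable {k : Type*} [Field k] {ω : k} {d : ℕ}

theorem qBinom_primitiveRoot (hω : IsPrimitiveRoot ω d) (n₀ : Fin d) (m : ℕ) :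
    qBinom ω n₀ m = gaussCoeff ω n₀ m :=
  qBinom_eq_gaussCoeff ω (fun _ h0 hi =>
    hω.pow_ne_one_of_pos_of_lt h0.ne' (lt_of_le_of_lt hi n₀.2)) m

theorem mul_qBinom_mem_polyClosure (hd : 0 < d) (hω : IsPrimitiveRoot ω d) (n₀ : Fin d)
    {w : ℕ → k} (hw : w ∈ polyClosure fun n m : ℕ => (n.choose m : k)) :
    (fun m => w (m / d) * qBinom ω n₀ (m % d)) ∈ polyClosure (gaussCoeff ω) := by
  simp only [qBinom_primitiveRoot hω]
  exact mem_polyClosure_of_primitiveRoot hd hω n₀.2 hw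

theorem existsUnique_parameter (hd : 0 < d) (hω : IsPrimitiveRoot ω d) {T : Type*}
    (f : Fin d → T → ℕ → k) (hinj : ∀ n₀, Function.Injective (f n₀))
    (hf : ∀ n₀ t, f n₀ t ∈ polyClosure fun n m : ℕ => (n.choose m : k))
    (hsurj : ∀ n₀, ∀ w ∈ polyClosure fun n m : ℕ => (n.choose m : k), ∃ t, w = f n₀ t)
    {v : ℕ → k} (hv : v ∈ polyClosure (gaussCoeff ω)) :
    ∃! a : Fin d × T, ∀ m, v m = f a.1 a.2 (m / d) * qBinom ω a.1 (m % d) := by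
  simp only [qBinom_primitiveRoot hω]
  refine existsUnique_of_exists_of_unique ?_ ?_
  · obtain ⟨n₀, hn₀, w, hw, h⟩ := exists_of_mem_polyClosure_primitiveRoot hd hω hv
    obtain ⟨t, rfl⟩ := hsurj ⟨n₀, hn₀⟩ w hw
    exact ⟨(⟨n₀, hn₀⟩, t), h⟩
  · rintro ⟨n₀, t⟩ ⟨n₁, u⟩ h h'
    have h0 : ∀ n t, f n t 0 = 1 := fun n t => by
      have := eval_eq_eval_of_mem_polyClosure (hf n t) (F := MvPolynomial.X 0) (G := 1)
        fun i => by simp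
      simpa using this
    obtain rfl : n₀ = n₁ := by
      refine Fin.ext (gaussCoeff_row_injective ω n₀.2 n₁.2 fun m hm => ?_)
      have := (h m).symm.trans (h' m)
      simpa only [Nat.div_eq_of_lt hm, Nat.mod_eq_of_lt hm, h0, one_mul] using this
    obtain rfl : t = u := by
      refine hinj n₀ (funext fun m => ?_)
      have := (h (d * m)).symm.trans (h' (d * m))
      simpa only [Nat.mul_div_cancel_left _ hd, Nat.mul_mod_right, gaussCoeff_zero_right,
        mul_one] using this
    rfl

theorem existsUnique_parameter_charZero [CharZero k] (hd : 0 < d) (hω : IsPrimitiveRoot ω d)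
    {v : ℕ → k} (hv : v ∈ polyClosure (gaussCoeff ω)) :
    ∃! a : Fin d × k, ∀ m, v m =
      binomZero ((a.2 - ((a.1 : ℕ) : k)) / (d : k)) (m / d) * qBinom ω a.1 (m % d) := by
  have hd0 : (d : k) ≠ 0 := Nat.cast_ne_zero.mpr hd.ne'
  refine existsUnique_parameter hd hω (fun n₀ t => binomZero ((t - ((n₀ : ℕ) : k)) / (d : k)))
    (fun n₀ t u h => ?_) (fun n₀ t => binomZero_mem_polyClosure _) (fun n₀ w hw => ?_) hv
  · have := congrFun h 1
    simp only [binomZero_one] at this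
    exact sub_left_injective ((div_left_inj' hd0).mp this)
  · obtain ⟨s, rfl⟩ := exists_binomZero hw
    exact ⟨s * d + (n₀ : ℕ), by rw [add_sub_cancel_right, mul_div_cancel_right₀ _ hd0]⟩

theorem existsUnique_parameter_charP {p : ℕ} [Fact p.Prime] [CharP k p] (hd : 0 < d)
    (hω : IsPrimitiveRoot ω d) {v : ℕ → k} (hv : v ∈ polyClosure (gaussCoeff ω)) :
    ∃! a : Fin d × ℤ_[p], ∀ m, v m =
      binomPadic k (padicShift d a.1 a.2) (m / d) * qBinom ω a.1 (m % d) := by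
  have hb : ∀ n₀ : ℕ, Function.Bijective (padicShift d n₀ : ℤ_[p] → ℤ_[p]) :=
    padicShift_bijective (not_dvd_of_isPrimitiveRoot hd hω)
  refine existsUnique_parameter hd hω (fun n₀ t => binomPadic k (padicShift d n₀ t))
    (fun n₀ => (binomPadic_injective k).comp (hb n₀).1)
    (fun n₀ t => binomPadic_mem_polyClosure k _) (fun n₀ w hw => ?_) hv
  obtain ⟨s, rfl⟩ := exists_binomPadic k (p := p) hw
  obtain ⟨t, rfl⟩ := (hb n₀).2 s
  exact ⟨t, rfl⟩

/-- The limits of Gaussian binomial coefficients at a non-zero element, by parameters. -/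
theorem polyClosure_classification {κ : k} (hκ : κ ≠ 0) {v : ℕ → k}
    (hv : v ∈ polyClosure (gaussCoeff κ)) :
    (∃ d : ℕ, 0 < d ∧ IsPrimitiveRoot κ d ∧
      (CharZero k → ∃! a : Fin d × k, ∀ m, v m =
        binomZero ((a.2 - ((a.1 : ℕ) : k)) / (d : k)) (m / d) * qBinom κ a.1 (m % d)) ∧
      (∀ (p : ℕ) [Fact p.Prime] [CharP k p], ∃! a : Fin d × ℤ_[p], ∀ m, v m =
        binomPadic k (padicShift d a.1 a.2) (m / d) * qBinom κ a.1 (m % d))) ∨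
    (κ ≠ 0 ∧ (∀ n : ℕ, 0 < n → κ ^ n ≠ 1) ∧ ∃! t : k, ∀ m, v m = (qBinomPoly κ m).eval t) := by
  by_cases h : ∀ n : ℕ, 0 < n → κ ^ n ≠ 1
  · exact Or.inr ⟨hκ, h, existsUnique_eval_qBinomPoly hκ h hv⟩
  · push Not at h
    have hd : 0 < orderOf κ := orderOf_pos_iff.mpr (isOfFinOrder_iff_pow_eq_one.mpr h)
    have hω := IsPrimitiveRoot.orderOf κ
    exact Or.inl ⟨orderOf κ, hd, hω, fun _ => existsUnique_parameter_charZero hd hω hv,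
      fun p _ _ => existsUnique_parameter_charP hd hω hv⟩

end parameters

end

end QIntVal

open QIntVal in
theorem mainTheorem1 (k : Type*) [Field k] :
    -- the ring `R_q^+`: each choice of parameters gives exactly one ring homomorphism
    ((∀ N : ℕ∞, ∃! φ : RqPlus →+* k,
        φ RqPlus.q = 0 ∧ ∀ m : ℕ, φ (RqPlus.binom m) = if (m : ℕ∞) ≤ N then 1 else 0) ∧
      (∀ (d : ℕ) (ω : k), 0 < d → IsPrimitiveRoot ω d → ∀ n₀ : Fin d,
        (CharZero k → ∀ t : k, ∃! φ : RqPlus →+* k, φ RqPlus.q = ω ∧ ∀ m : ℕ,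
          φ (RqPlus.binom m) =
            binomZero ((t - ((n₀ : ℕ) : k)) / (d : k)) (m / d) * qBinom ω n₀ (m % d)) ∧
        (∀ (p : ℕ) [Fact p.Prime] [CharP k p] (t : ℤ_[p]), ∃! φ : RqPlus →+* k,
          φ RqPlus.q = ω ∧ ∀ m : ℕ,
          φ (RqPlus.binom m) =
            binomPadic k (padicShift d n₀ t) (m / d) * qBinom ω n₀ (m % d))) ∧
      (∀ κ t : k, κ ≠ 0 → (∀ n : ℕ, 0 < n → κ ^ n ≠ 1) → ∃! φ : RqPlus →+* k,
        φ RqPlus.q = κ ∧ ∀ m : ℕ, φ (RqPlus.binom m) = (qBinomPoly κ m).eval t) ∧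
      -- and every ring homomorphism arises from exactly one choice
      (∀ φ : RqPlus →+* k,
        (φ RqPlus.q = 0 ∧
          ∃! N : ℕ∞, ∀ m : ℕ, φ (RqPlus.binom m) = if (m : ℕ∞) ≤ N then 1 else 0) ∨
        (∃ d : ℕ, 0 < d ∧ IsPrimitiveRoot (φ RqPlus.q) d ∧
          (CharZero k → ∃! a : Fin d × k, ∀ m : ℕ,
            φ (RqPlus.binom m) =
              binomZero ((a.2 - ((a.1 : ℕ) : k)) / (d : k)) (m / d) *
                qBinom (φ RqPlus.q) a.1 (m % d)) ∧
          (∀ (p : ℕ) [Fact p.Prime] [CharP k p], ∃! a : Fin d × ℤ_[p], ∀ m : ℕ,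
            φ (RqPlus.binom m) =
              binomPadic k (padicShift d a.1 a.2) (m / d) *
                qBinom (φ RqPlus.q) a.1 (m % d))) ∨
        (φ RqPlus.q ≠ 0 ∧ (∀ n : ℕ, 0 < n → φ RqPlus.q ^ n ≠ 1) ∧
          ∃! t : k, ∀ m : ℕ, φ (RqPlus.binom m) = (qBinomPoly (φ RqPlus.q) m).eval t))) ∧
    -- the ring `R_q`: the same list without the case in which `q` is sent to `0`
    ((∀ (d : ℕ) (ω : k), 0 < d → IsPrimitiveRoot ω d → ∀ n₀ : Fin d,
        (CharZero k → ∀ t : k, ∃! φ : Rq →+* k, φ Rq.q = ω ∧ ∀ m : ℕ,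
          φ (Rq.binom m) =
            binomZero ((t - ((n₀ : ℕ) : k)) / (d : k)) (m / d) * qBinom ω n₀ (m % d)) ∧
        (∀ (p : ℕ) [Fact p.Prime] [CharP k p] (t : ℤ_[p]), ∃! φ : Rq →+* k,
          φ Rq.q = ω ∧ ∀ m : ℕ,
          φ (Rq.binom m) =
            binomPadic k (padicShift d n₀ t) (m / d) * qBinom ω n₀ (m % d))) ∧
      (∀ κ t : k, κ ≠ 0 → (∀ n : ℕ, 0 < n → κ ^ n ≠ 1) → ∃! φ : Rq →+* k,
        φ Rq.q = κ ∧ ∀ m : ℕ, φ (Rq.binom m) = (qBinomPoly κ m).eval t) ∧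
      (∀ φ : Rq →+* k,
        (∃ d : ℕ, 0 < d ∧ IsPrimitiveRoot (φ Rq.q) d ∧
          (CharZero k → ∃! a : Fin d × k, ∀ m : ℕ,
            φ (Rq.binom m) =
              binomZero ((a.2 - ((a.1 : ℕ) : k)) / (d : k)) (m / d) *
                qBinom (φ Rq.q) a.1 (m % d)) ∧
          (∀ (p : ℕ) [Fact p.Prime] [CharP k p], ∃! a : Fin d × ℤ_[p], ∀ m : ℕ,
            φ (Rq.binom m) =
              binomPadic k (padicShift d a.1 a.2) (m / d) *
                qBinom (φ Rq.q) a.1 (m % d))) ∨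
        (φ Rq.q ≠ 0 ∧ (∀ n : ℕ, 0 < n → φ Rq.q ^ n ≠ 1) ∧
          ∃! t : k, ∀ m : ℕ, φ (Rq.binom m) = (qBinomPoly (φ Rq.q) m).eval t))) := by
  refine ⟨⟨fun N => RqPlus.existsUnique_ringHom (step_mem_polyClosure N), fun d ω hd hω n₀ =>
    ⟨fun _ t => RqPlus.existsUnique_ringHom
        (mul_qBinom_mem_polyClosure hd hω n₀ (binomZero_mem_polyClosure _)),
      fun p _ _ t => RqPlus.existsUnique_ringHom
        (mul_qBinom_mem_polyClosure hd hω n₀ (binomPadic_mem_polyClosure k _))⟩,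
    fun κ t h0 h => RqPlus.existsUnique_ringHom (eval_qBinomPoly_mem_polyClosure h0 h t),
    fun φ => ?_⟩, fun d ω hd hω n₀ =>
    ⟨fun _ t => Rq.existsUnique_ringHom (hω.ne_zero hd.ne')
        (mul_qBinom_mem_polyClosure hd hω n₀ (binomZero_mem_polyClosure _)),
      fun p _ _ t => Rq.existsUnique_ringHom (hω.ne_zero hd.ne')
        (mul_qBinom_mem_polyClosure hd hω n₀ (binomPadic_mem_polyClosure k _))⟩,
    fun κ t h0 h => Rq.existsUnique_ringHom h0 (eval_qBinomPoly_mem_polyClosure h0 h t),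
    fun φ => polyClosure_classification (Rq.map_q_ne_zero φ) (Rq.mem_polyClosure φ)⟩
  have hv := RqPlus.mem_polyClosure φ
  by_cases h0 : φ RqPlus.q = 0
  · rw [h0] at hv
    exact Or.inl ⟨h0, existsUnique_step hv⟩
  · exact Or.inr (polyClosure_classification h0 hv)
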